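/- Let $g\ge 2$ and let $$\Gamma_g=\langle a_1,\dots,a_g,b_1,\dots,b_g \mid [a_1,b_1]\cdots[a_g,b_g]\rangle,\qquad [a,b]=aba^{-1}b^{-1},$$ be the surface group of genus $g$ with its standard presentation. Let $d$ be the word metric on $\Gamma_g$ with respect to $A=\{a_i^{\pm1},b_i^{\pm1}\}$, that is, the distance in the Cayley graph, and let $e$ be the identity. A word $w$ over $A$ is called geodesic if its length equals $d(e,w)$. The (Cannon) cone type of $x\in\Gamma_g$ is the set $\mathcal C(x)$ of all reduced words $z$ over $A$ such that $d(e,xz)=d(e,x)+|z|$, where $|z|$ is the length of $z$. Let $\mathcal R\subset\Gamma_g$ be the set of elements represented by a nonempty geodesic word of length at most $2g$ that is a (contiguous) subword of a cyclic permutation of the relator $[a_1,b_1]\cdots[a_g,b_g]$ or of its inverse $[b_g,a_g]\cdots[b_1,a_1]$. Then: 1. The cone types of $\Gamma_g$ other than $\mathcal C(e)$ are exactly the sets $\mathcal C(x)$ with $x\in\mathcal R$. 2. Distinct elements of $\mathcal R$ have distinct cone types. 3. There are exactly $8g(2g-1)$ cone types other than $\mathcal C(e)$, hence exactly $8g(2g-1)+1$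 cone types in all. -/

import Mathlib

namespace SurfaceCone

/-- The generators of the genus `g` surface group: `Sum.inl i` is `a_i` and `Sum.inr i` is `b_i`. -/
abbrev Gen (g : ℕ) : Type := Fin g ⊕ Fin g

/-- Letters: a generator together with a sign (`true` for the generator, `false` for its inverse). -/
abbrev Letter (g : ℕ) : Type := Gen g × Bool

/-- The word `[a_1,b_1] ⋯ [a_g,b_g]`, where `[a,b] = a b a⁻¹ b⁻¹`. -/
def relatorWord (g : ℕ) : List (Letter g) :=
  (List.finRange g).flatMap fun i =>
    [(Sum.inl i, true), (Sum.inr i, true), (Sum.inl i, false), (Sum.inr i, false)]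

/-- The relator as an element of the free group, a product of commutators. -/
def relator (g : ℕ) : FreeGroup (Gen g) :=
  ((List.finRange g).map fun i =>
    FreeGroup.of (Sum.inl i : Gen g) * FreeGroup.of (Sum.inr i) *
      (FreeGroup.of (Sum.inl i))⁻¹ * (FreeGroup.of (Sum.inr i))⁻¹).prod

theorem mk_relatorWord (g : ℕ) : FreeGroup.mk (relatorWord g) = relator g := by
  unfold relatorWord relator
  induction List.finRange g with
  | nil => rfl
  | cons i l ih =>
    rw [List.flatMap_cons, ← FreeGroup.mul_mk, ih, List.map_cons, List.prod_cons]
    rfl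

/-- The surface group `Γ_g = ⟨a_1, …, a_g, b_1, …, b_g | [a_1,b_1] ⋯ [a_g,b_g]⟩`. -/
abbrev SurfaceGroup (g : ℕ) : Type := PresentedGroup ({relator g} : Set (FreeGroup (Gen g)))

/-- The canonical projection `F(A) → Γ_g`. -/
abbrev proj (g : ℕ) : FreeGroup (Gen g) →* SurfaceGroup g :=
  PresentedGroup.mk ({relator g} : Set (FreeGroup (Gen g)))

/-- The element of `Γ_g` represented by a word in the letters `a_i^{±1}`, `b_i^{±1}`. -/
def eval {g : ℕ} (w : List (Letter g)) : SurfaceGroup g := proj g (FreeGroup.mk w)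

/-- The Cayley graph of `Γ_g`: distinct elements `x`, `y` are adjacent if and only if `y = x s` for
a generator or an inverse of a generator `s`. -/
def cayleyGraph (g : ℕ) : SimpleGraph (SurfaceGroup g) :=
  SimpleGraph.mulCayley (Set.range (PresentedGroup.of : Gen g → SurfaceGroup g))

/-- The Cayley graph is connected, so its graph distance is the word metric. -/
theorem cayleyGraph_connected (g : ℕ) : (cayleyGraph g).Connected := by
  have step : ∀ (x : SurfaceGroup g) (s : Gen g),
      (cayleyGraph g).Reachable x (x * PresentedGroup.of s) := by
    intro x s
    by_cases h : x = x * PresentedGroup.of s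
    · rw [← h]
    · exact SimpleGraph.Adj.reachable
        ((SimpleGraph.mulCayley_adj' _ _ _).2 ⟨h, _, ⟨s, rfl⟩, Or.inl rfl⟩)
  have key : ∀ y x : SurfaceGroup g, (cayleyGraph g).Reachable x (x * y) := by
    intro y
    have hy : y ∈ Subgroup.closure
        (Set.range (PresentedGroup.of : Gen g → SurfaceGroup g)) := by
      rw [PresentedGroup.closure_range_of]; trivial
    induction hy using Subgroup.closure_induction with
    | mem y hy => obtain ⟨s, rfl⟩ := hy; exact fun x => step x s
    | one => intro x; rw [mul_one]
    | mul a b _ _ ha hb => intro x; rw [← mul_assoc]; exact (ha x).trans (hb _)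
    | inv a _ ha => intro x; simpa using (ha (x * a⁻¹)).symm
  have : Nonempty (SurfaceGroup g) := ⟨1⟩
  exact ⟨fun x y => by simpa using key (x⁻¹ * y) x⟩

/-- The word metric `d` on `Γ_g`. -/
noncomputable def d {g : ℕ} (x y : SurfaceGroup g) : ℕ := (cayleyGraph g).dist x y

/-- The Cannon cone type of `x`: the reduced words `z` with `d(e, xz) = d(e, x) + |z|`. Elements of
the free group are identified with reduced words and `FreeGroup.norm` is the length of that word. -/
def coneType {g : ℕ} (x : SurfaceGroup g) : Set (FreeGroup (Gen g)) :=
  {z | d 1 (x * proj g z) = d 1 x + z.norm}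

/-- A word is geodesic if its length is the distance from `e` to the element it represents. -/
def IsGeodesicWord {g : ℕ} (w : List (Letter g)) : Prop := d 1 (eval w) = w.length

/-- `w` is a nonempty geodesic word of length at most `2g` that is a (contiguous) subword of a cyclic
permutation of the relator or of its inverse. -/
def IsShortRelatorSubword {g : ℕ} (w : List (Letter g)) : Prop :=
  w ≠ [] ∧ w.length ≤ 2 * g ∧ IsGeodesicWord w ∧
    ∃ r : List (Letter g),
      (r ~r relatorWord g ∨ r ~r FreeGroup.invRev (relatorWord g)) ∧ w <:+: r

/-- The elements of `Γ_g` represented by such words. -/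
def shortRelatorElements (g : ℕ) : Set (SurfaceGroup g) :=
  {x | ∃ w : List (Letter g), IsShortRelatorSubword w ∧ eval w = x}

end SurfaceCone

/-! Geodesics are read by an automaton. In the tessellation by `4g`-gons a geodesic follows a
polygon for at most half its boundary, and only at the top of a polygon do two edges lead back. The
state is thus the last letter with the direction and length of the final run, or a top, and a cone
type is the language accepted from a state. To see that the automaton describes the group, take
accepted words modulo exchanging the two halves of polygons; `Equivalent.trans_of_length` makes this
an equivalence relation. Every letter permutes the classes, because each downward letter undoes the
last letter of some equivalent word (`exists_equivalent_aux`). Polygon boundaries act trivially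
(`Vertex.moves_path_full`), so the surface group acts. A letter changes the length of a class by
one, so no word beats the accepted one: this is `dist_one_eq_len`, which gives
`coneType_eq_language`. States are separated by their downward letters and by how far a polygon can
still be followed (`eq_of_accepts_iff`). Short relator elements realise each state other than
`start` exactly once (`exists_coneState_eq`, `coneState_injOn`), so counting states counts cone
types. -/

namespace SurfaceCone

/-! ### Letters and the cyclic order of the relator -/

/-- The inverse letter. -/
def bar {g : ℕ} (s : Letter g) : Letter g := (s.1, !s.2)

/-- The letter that follows `s` in the cyclic relator (`true`) or in its inverse (`false`). -/
def nu {g : ℕ} : Bool → Letter g → Letter g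
  | true, (Sum.inl i, true) => (Sum.inr i, true)
  | true, (Sum.inr i, true) => (Sum.inl i, false)
  | true, (Sum.inl i, false) => (Sum.inr i, false)
  | true, (Sum.inr i, false) => (Sum.inl (finRotate g i), true)
  | false, (Sum.inl i, true) => (Sum.inr i, false)
  | false, (Sum.inr i, true) => (Sum.inl i, true)
  | false, (Sum.inl i, false) => (Sum.inr ((finRotate g).symm i), true)
  | false, (Sum.inr i, false) => (Sum.inl i, false)

variable {g : ℕ}

@[simp] theorem bar_bar (s : Letter g) : bar (bar s) = s := by simp [bar]

theorem bar_injective : Function.Injective (bar : Letter g → Letter g) :=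
  Function.LeftInverse.injective bar_bar

@[simp] theorem bar_inj {s t : Letter g} : bar s = bar t ↔ s = t := bar_injective.eq_iff

-- Reading a polygon backwards inverts its letters and reverses their order.
@[simp] theorem nu_not_bar_nu (ε : Bool) (s : Letter g) : nu (!ε) (bar (nu ε s)) = bar s := by
  rcases ε with _ | _ <;> rcases s with ⟨_ | _, _ | _⟩ <;>
    simp only [nu, bar, Bool.not_true, Bool.not_false, Equiv.apply_symm_apply,
      Equiv.symm_apply_apply]

@[simp] theorem nu_bar_nu_not (ε : Bool) (s : Letter g) : nu ε (bar (nu (!ε) s)) = bar s := by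
  simpa using nu_not_bar_nu (!ε) s

@[simp] theorem nu_true_bar_nu_false (s : Letter g) : nu true (bar (nu false s)) = bar s :=
  nu_bar_nu_not true s

@[simp] theorem nu_false_bar_nu_true (s : Letter g) : nu false (bar (nu true s)) = bar s :=
  nu_not_bar_nu true s

theorem nu_injective (ε : Bool) : Function.Injective (nu ε : Letter g → Letter g) := by
  intro s t h
  have := nu_not_bar_nu ε s
  rwa [h, nu_not_bar_nu, bar_inj, eq_comm] at this

@[simp] theorem nu_inj (ε : Bool) {s t : Letter g} : nu ε s = nu ε t ↔ s = t :=
  (nu_injective ε).eq_iff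

-- The map `c ↦ nu ε (bar c)` turns from one edge at a vertex to the next and runs through `nu (!ε)
-- s`, `bar s`, `nu ε s`, `nu ε (bar (nu ε s))`. This lemma and the next three keep these four edges
-- apart.
@[simp] theorem nu_ne_bar (ε : Bool) (s : Letter g) : nu ε s ≠ bar s := by
  rcases ε with _ | _ <;> rcases s with ⟨_ | _, _ | _⟩ <;> simp [nu, bar]

theorem nu_ne_nu_not (ε : Bool) (s : Letter g) : nu ε s ≠ nu (!ε) s := by
  rcases ε with _ | _ <;> rcases s with ⟨_ | _, _ | _⟩ <;> simp [nu]

theorem nu_bar_nu_ne_nu_not (ε : Bool) (s : Letter g) : nu ε (bar (nu ε s)) ≠ nu (!ε) s := by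
  rcases ε with _ | _ <;> rcases s with ⟨_ | _, _ | _⟩ <;> simp [nu, bar]

theorem nu_bar_nu_ne_bar (ε : Bool) (s : Letter g) : nu ε (bar (nu ε s)) ≠ bar s := by
  rcases ε with _ | _ <;> rcases s with ⟨_ | _, _ | _⟩ <;> simp [nu, bar]

theorem nu_iterate_bar (ε : Bool) (k : ℕ) (s : Letter g) :
    (nu ε)^[k] (bar ((nu (!ε))^[k] s)) = bar s := by
  induction k generalizing s with
  | zero => rfl
  | succ k ih =>
    rw [Function.iterate_succ_apply, Function.iterate_succ_apply', nu_bar_nu_not, ih]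

theorem nu_true_iterate_four (k : ℕ) (i : Fin g) :
    (nu true)^[4 * k] ((Sum.inl i, true) : Letter g) = (Sum.inl ((finRotate g)^[k] i), true) := by
  induction k generalizing i with
  | zero => rfl
  | succ k ih =>
    rw [Nat.mul_succ, Function.iterate_add_apply, Function.iterate_succ_apply]
    exact ih _

theorem finRotate_iterate_val (k : ℕ) (i : Fin g) :
    (((finRotate g)^[k] i : Fin g) : ℕ) = (i + k) % g := by
  induction k with
  | zero => simp [Nat.mod_eq_of_lt i.2]
  | succ k ih =>
    rw [Function.iterate_succ_apply']
    obtain ⟨m, rfl⟩ : ∃ m, g = m + 1 := ⟨g - 1, by have := i.2; omega⟩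
    rw [finRotate_apply, Fin.val_add, ih, Fin.val_one']
    simp [← add_assoc]

theorem exists_nu_iterate (ε : Bool) (s : Letter g) : ∃ i : Fin g, ∃ k,
    (nu ε)^[k] s = (Sum.inl i, true) := by
  rcases ε with _ | _ <;> rcases s with ⟨i | i, _ | _⟩
  · exact ⟨_, 2, rfl⟩
  · exact ⟨_, 0, rfl⟩
  · exact ⟨_, 3, rfl⟩
  · exact ⟨_, 1, rfl⟩
  · exact ⟨_, 2, rfl⟩
  · exact ⟨_, 0, rfl⟩
  · exact ⟨_, 1, rfl⟩
  · exact ⟨_, 3, rfl⟩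

theorem nu_true_period (s : Letter g) : (nu true)^[4 * g] s = s := by
  obtain ⟨i, k, hk⟩ := exists_nu_iterate true s
  apply (nu_injective true).iterate k
  rw [← Function.iterate_add_apply, add_comm, Function.iterate_add_apply, hk, nu_true_iterate_four]
  congr 2
  ext
  simp [finRotate_iterate_val, Nat.mod_eq_of_lt i.2]

theorem nu_period (ε : Bool) (s : Letter g) : (nu ε)^[4 * g] s = s := by
  cases ε
  · have := nu_iterate_bar true (4 * g) s
    rwa [nu_true_period, bar_inj] at this
  · exact nu_true_period s

/-- The two halves of a polygon end in letters that are related by `nu`. -/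
theorem bar_iterate_eq_nu {k : ℕ} (hk : k + 1 = 2 * g) (ε : Bool) (s : Letter g) :
    bar ((nu (!ε))^[k] (nu (!ε) (bar s))) = nu ε ((nu ε)^[k] s) := by
  rw [← Function.iterate_succ_apply, ← Function.iterate_succ_apply' (nu ε), Nat.succ_eq_add_one, hk]
  apply (nu_injective ε).iterate (2 * g)
  rw [nu_iterate_bar, ← Function.iterate_add_apply, show 2 * g + 2 * g = 4 * g by ring, nu_period,
    bar_bar]

theorem iterate_not_eq_bar_nu {k : ℕ} (hk : k + 1 = 2 * g) (ε : Bool) (s : Letter g) :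
    (nu (!ε))^[k] (nu (!ε) (bar s)) = bar (nu ε ((nu ε)^[k] s)) := by
  rw [← bar_iterate_eq_nu hk, bar_bar]

/-! ### The automaton -/

/-- States of the automaton that recognises geodesics: `one s` and `run ε s l` record the last letter
`s` and the length `l` of the final run along a relator in direction `ε`; `top s` is the top of a
polygon, reached along the relator by the letter `s`. -/
inductive ConeState (g : ℕ) : Type
  | start : ConeState g
  | one (s : Letter g) : ConeState g
  | run (ε : Bool) (s : Letter g) (l : ℕ) : ConeState g
  | top (s : Letter g) : ConeState g

namespace ConeState

/-- The top of a polygon that is reached in direction `ε` by the letter `s`. -/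
def mkTop (ε : Bool) (s : Letter g) : ConeState g := top (if ε then s else bar (nu false s))

/-- The letters that lead back towards the identity. -/
def IsDown : ConeState g → Letter g → Prop
  | start, _ => False
  | one s, t => t = bar s
  | run _ s _, t => t = bar s
  | top s, t => t = bar s ∨ t = nu true s

/-- The transition function. -/
def step : ConeState g → Letter g → ConeState g
  | start, t => one t
  | one s, t =>
    if t = nu true s then run true t 2 else if t = nu false s then run false t 2 else one t
  | run ε s l, t =>
    -- A run of length `2g` has covered half the polygon and ends at its top.
    if t = nu ε s then (if l + 1 < 2 * g then run ε t (l + 1) else mkTop ε t)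
    else if t = nu (!ε) s then run (!ε) t 2 else one t
  | top s, t =>
    -- A top has two possible last letters, `s` and `bar (nu true s)`; each can be continued along
    -- the polygon on its outer side, starting a run of length 2.
    if t = nu false s then run false t 2
    else if t = nu true (bar (nu true s)) then run true t 2 else one t

theorem isDown_mkTop {ε : Bool} {s t : Letter g} :
    IsDown (mkTop ε s) t ↔ t = bar s ∨ t = nu ε s := by
  cases ε <;> simp [mkTop, IsDown, or_comm]

theorem step_mkTop (ε : Bool) (s t : Letter g) :
    step (mkTop ε s) t = if t = nu (!ε) s then run (!ε) t 2
      else if t = nu ε (bar (nu ε s)) then run ε t 2 else one t := by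
  cases ε
  · have := nu_bar_nu_ne_nu_not false s
    simp only [mkTop, step]
    simp
    split_ifs <;> simp_all
  · simp [mkTop, step]

theorem step_one (ε : Bool) (s t : Letter g) :
    step (one s) t = if t = nu ε s then run ε t 2
      else if t = nu (!ε) s then run (!ε) t 2 else one t := by
  cases ε
  · have := nu_ne_nu_not false s
    simp only [step]
    split_ifs <;> simp_all
  · simp [step]

theorem mkTop_not (ε : Bool) (s : Letter g) : mkTop (!ε) (bar (nu ε s)) = mkTop ε s := by
  cases ε <;> simp [mkTop]

theorem exists_eq_mkTop (ε : Bool) (s : Letter g) : ∃ t, top s = mkTop ε t := by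
  cases ε
  · exact ⟨bar (nu true s), by simp [mkTop]⟩
  · exact ⟨s, by simp [mkTop]⟩

@[simp] theorem mkTop_inj {ε : Bool} {s t : Letter g} : mkTop ε s = mkTop ε t ↔ s = t := by
  cases ε <;> simp [mkTop]

/-- The polygon on the `ε`-side of the last edge `s` has its bottom just below that edge. -/
def Flat (ε : Bool) (s : Letter g) (q : ConeState g) : Prop :=
  q = one s ∨ (∃ l, q = run (!ε) s l) ∨ q = mkTop (!ε) s

/-- The vertex is the bottom of the polygon at the corner between `s` and its neighbour. -/
def IsBottom (ε : Bool) (s : Letter g) (q : ConeState g) : Prop :=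
  ¬ q.IsDown s ∧ ¬ q.IsDown (nu (!ε) (bar s))

theorem IsBottom.not {ε : Bool} {s : Letter g} {q : ConeState g} (h : IsBottom ε s q) :
    IsBottom (!ε) (nu (!ε) (bar s)) q := by
  refine ⟨h.2, ?_⟩
  simpa using h.1

/-- Otherwise `s` would continue the `ε`-side polygon from an edge below, and the other edge of the
corner, `nu (!ε) (bar s)`, would lead down. -/
theorem IsBottom.flat {ε : Bool} {s : Letter g} {q : ConeState g} (h : IsBottom ε s q) :
    Flat ε s (step q s) := by
  obtain ⟨h1, h2⟩ := h
  rcases q with _ | u | ⟨δ, u, l⟩ | u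
  · exact Or.inl rfl
  · rw [step_one ε]
    split_ifs with h3 h4
    · subst h3; simp [IsDown] at h2
    · exact Or.inr (Or.inl ⟨2, rfl⟩)
    · exact Or.inl rfl
  · simp only [step]
    by_cases hδ : δ = ε
    · subst hδ
      rw [if_neg (by rintro rfl; simp [IsDown] at h2)]
      split_ifs
      · exact Or.inr (Or.inl ⟨2, rfl⟩)
      · exact Or.inl rfl
    · obtain rfl : δ = !ε := by cases δ <;> cases ε <;> simp_all
      simp only [Bool.not_not]
      split_ifs with h3 h4 h5
      · exact Or.inr (Or.inl ⟨_, rfl⟩)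
      · exact Or.inr (Or.inr rfl)
      · subst h5; simp [IsDown] at h2
      · exact Or.inl rfl
  · obtain ⟨t, ht⟩ := exists_eq_mkTop ε u
    rw [ht] at h1 h2 ⊢
    rw [step_mkTop]
    split_ifs with h3 h4
    · exact Or.inr (Or.inl ⟨_, rfl⟩)
    · subst h4; simp [isDown_mkTop] at h2
    · exact Or.inl rfl

theorem isBottom_of_flat {ε : Bool} {s : Letter g} {q : ConeState g} (h : ¬ q.IsDown s)
    (hf : Flat ε s (step q s)) : IsBottom ε s q := by
  refine ⟨h, fun h2 => ?_⟩
  have hs : s = nu ε (bar (nu (!ε) (bar s))) := by simp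
  generalize nu (!ε) (bar s) = c at h2 hs
  subst hs
  rcases q with _ | u | ⟨δ, u, l⟩ | u
  · exact h2
  · obtain rfl : c = bar u := h2
    rw [step_one ε] at hf
    cases ε <;> simp [Flat, mkTop] at hf
  · obtain rfl : c = bar u := h2
    simp only [step, bar_bar] at hf
    have h1 := nu_ne_nu_not ε u
    by_cases hδ : δ = ε
    · subst hδ
      rw [if_pos rfl] at hf
      split_ifs at hf
      · cases δ <;> simp [Flat, mkTop] at hf
      · rw [← mkTop_not] at hf
        rcases hf with hf | ⟨_, hf⟩ | hf
        · cases δ <;> simp [mkTop] at hf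
        · cases δ <;> simp [mkTop] at hf
        · rw [mkTop_inj] at hf
          exact nu_ne_bar δ (nu δ u) (by rw [← bar_inj, hf, bar_bar])
    · obtain rfl : δ = !ε := by cases δ <;> cases ε <;> simp_all
      rw [if_neg h1] at hf
      cases ε <;> simp [Flat, mkTop] at hf
  · obtain ⟨t, ht⟩ := exists_eq_mkTop ε u
    rw [ht] at h h2 hf
    rw [isDown_mkTop] at h h2
    rcases h2 with rfl | rfl
    · simp at h
    · rw [step_mkTop, if_neg (nu_bar_nu_ne_nu_not ε t), if_pos rfl] at hf
      cases ε <;> simp [Flat, mkTop] at hf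

theorem Flat.not_isDown_nu {ε : Bool} {s : Letter g} {q : ConeState g} (h : Flat ε s q) :
    ¬ q.IsDown (nu ε s) := by
  rcases h with rfl | ⟨l, rfl⟩ | rfl
  · simp [IsDown]
  · simp [IsDown]
  · rw [isDown_mkTop, not_or]
    exact ⟨nu_ne_bar _ _, nu_ne_nu_not _ _⟩

theorem Flat.step_nu {ε : Bool} {s : Letter g} {q : ConeState g} (h : Flat ε s q) :
    step q (nu ε s) = run ε (nu ε s) 2 := by
  rcases h with rfl | ⟨l, rfl⟩ | rfl
  · simp [step_one ε]
  · simp [step, nu_ne_nu_not ε s]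
  · simp [step_mkTop]

end ConeState

open ConeState

/-! ### Words and their equivalence -/

/-! Words are stored in reverse order: the head of the list is the last letter. -/

/-- The state reached by a word. -/
def stateOf : List (Letter g) → ConeState g
  | [] => .start
  | t :: w => (stateOf w).step t

/-- The words accepted by the automaton. -/
def Accepted : List (Letter g) → Prop
  | [] => True
  | t :: w => Accepted w ∧ ¬ (stateOf w).IsDown t

/-- The word `w` followed by `k` letters along a relator in direction `ε`, starting with `s`. -/
def walk (ε : Bool) (s : Letter g) (w : List (Letter g)) : ℕ → List (Letter g)
  | 0 => w
  | k + 1 => (nu ε)^[k] s :: walk ε s w k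

@[simp] theorem length_walk (ε : Bool) (s : Letter g) (w : List (Letter g)) (k : ℕ) :
    (walk ε s w k).length = w.length + k := by
  induction k with
  | zero => rfl
  | succ k ih => simp [walk, ih, add_assoc]

section
variable {ε : Bool} {s : Letter g} {w : List (Letter g)}

theorem ConeState.IsBottom.stateOf_walk (h : IsBottom ε s (stateOf w)) {k : ℕ}
    (hk : k + 2 < 2 * g) :
    stateOf (walk ε s w (k + 2)) = run ε ((nu ε)^[k + 1] s) (k + 2) := by
  induction k with
  | zero => exact h.flat.step_nu
  | succ k ih =>
    rw [walk, stateOf, ih (by omega), Function.iterate_succ_apply' _ (k + 1), step, if_pos rfl,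
      if_pos hk]

theorem ConeState.IsBottom.stateOf_walk_top (h : IsBottom ε s (stateOf w)) {k : ℕ}
    (hk : k + 3 = 2 * g) :
    stateOf (walk ε s w (k + 3)) = mkTop ε ((nu ε)^[k + 2] s) := by
  rw [walk, stateOf, h.stateOf_walk (by omega), Function.iterate_succ_apply' _ (k + 1), step,
    if_pos rfl, if_neg (by omega)]

theorem ConeState.IsBottom.accepted_walk (h : IsBottom ε s (stateOf w)) (hw : Accepted w) {k : ℕ}
    (hk : k ≤ 2 * g) : Accepted (walk ε s w k) := by
  induction k with
  | zero => exact hw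
  | succ k ih =>
    refine ⟨ih (by omega), ?_⟩
    rcases k with _ | _ | k
    · exact h.1
    · exact h.flat.not_isDown_nu
    · rw [h.stateOf_walk (by omega), Function.iterate_succ_apply' _ (k + 1)]
      exact nu_ne_bar _ _

end

/-- Words are equivalent if they differ by exchanging the two geodesic sides of polygons. -/
inductive Equivalent : List (Letter g) → List (Letter g) → Prop
  | nil : Equivalent [] []
  | cons (t : Letter g) {v w : List (Letter g)} : Equivalent v w → Equivalent (t :: v) (t :: w)
  -- With its last letter, a walk of `k + 2` letters is half a polygon. Allowing any `v`, `w`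
  -- equivalent to the two walks leaves at most one flip at the last letter, so that transitivity
  -- can be proved by induction on length.
  | flip (ε : Bool) (s : Letter g) {k : ℕ} {v w y : List (Letter g)} :
      k + 3 = 2 * g → IsBottom ε s (stateOf y) → Equivalent v (walk ε s y (k + 2)) →
      Equivalent w (walk (!ε) (nu (!ε) (bar s)) y (k + 2)) →
      Equivalent ((nu ε)^[k + 2] s :: v) ((nu (!ε))^[k + 2] (nu (!ε) (bar s)) :: w)

namespace Equivalent

theorem refl (w : List (Letter g)) : Equivalent w w := by
  induction w with
  | nil => exact nil
  | cons t w ih => exact ih.cons t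

theorem symm {v w : List (Letter g)} (h : Equivalent v w) : Equivalent w v := by
  induction h with
  | nil => exact nil
  | cons t _ ih => exact ih.cons t
  | flip ε s hk hb h1 h2 ih1 ih2 =>
    have := flip (!ε) (nu (!ε) (bar s)) hk hb.not h2 (by simpa using h1)
    simpa using this

theorem length_eq {v w : List (Letter g)} (h : Equivalent v w) : v.length = w.length := by
  induction h with
  | nil => rfl
  | cons t _ ih => simp [ih]
  | flip ε s hk hb h1 h2 ih1 ih2 => simp_all

/-- Both halves of a flipped polygon end at the same top, by `mkTop_not`. -/
theorem stateOf_eq {v w : List (Letter g)} (h : Equivalent v w) : stateOf v = stateOf w := by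
  induction h with
  | nil => rfl
  | cons t _ ih => simp [stateOf, ih]
  | @flip ε s k v w y hk hb h1 h2 ih1 ih2 =>
    rw [stateOf, stateOf, ih1, ih2]
    have e1 := hb.stateOf_walk_top hk
    have e2 := hb.not.stateOf_walk_top hk
    rw [walk, stateOf] at e1 e2
    rw [e1, e2, iterate_not_eq_bar_nu (by omega), mkTop_not]

theorem accepted_iff {v w : List (Letter g)} (h : Equivalent v w) : Accepted v ↔ Accepted w := by
  induction h with
  | nil => rfl
  | cons t h ih => simp [Accepted, ih, h.stateOf_eq]
  | @flip ε s k v w y hk hb h1 h2 ih1 ih2 =>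
    rw [Accepted, Accepted, ih1, ih2, h1.stateOf_eq, h2.stateOf_eq]
    have key : ∀ {j : ℕ} {δ : Bool} {u : Letter g}, Accepted (walk δ u y j) → Accepted y := by
      intro j δ u h
      induction j with
      | zero => exact h
      | succ j ih => exact ih h.1
    have e1 : Accepted y → _ := fun hy => hb.accepted_walk hy (k := k + 3) (by omega)
    have e2 : Accepted y → _ := fun hy => hb.not.accepted_walk hy (k := k + 3) (by omega)
    exact ⟨fun h => e2 (key h.1), fun h => e1 (key h.1)⟩

/-- A flip changes the last letter: equality would give `nu ε x = bar x` for the last letter `x`. -/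
theorem of_cons {t : Letter g} {v w : List (Letter g)} (h : Equivalent (t :: v) (t :: w)) :
    Equivalent v w := by
  generalize h1 : t :: v = a at h
  generalize h2 : t :: w = b at h
  cases h with
  | nil => simp at h1
  | cons => simp_all
  | @flip ε s k v w y hk hb e1 e2 =>
    exfalso
    simp only [List.cons.injEq] at h1 h2
    have h3 := h1.1.symm.trans h2.1
    rw [iterate_not_eq_bar_nu (by omega)] at h3
    have := nu_ne_bar ε ((nu ε)^[k + 2] s)
    apply this
    rw [← bar_inj, bar_bar, ← h3]

theorem of_walk {ε : Bool} {s : Letter g} {k : ℕ} {v w : List (Letter g)}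
    (h : Equivalent (walk ε s v k) (walk ε s w k)) : Equivalent v w := by
  induction k with
  | zero => exact h
  | succ k ih => exact ih h.of_cons

theorem walk (ε : Bool) (s : Letter g) (k : ℕ) {v w : List (Letter g)}
    (h : Equivalent v w) : Equivalent (walk ε s v k) (walk ε s w k) := by
  induction k with
  | zero => exact h
  | succ k ih => exact ih.cons _

theorem trans_of_length (n : ℕ) : ∀ {u v w : List (Letter g)}, u.length ≤ n → Equivalent u v →
    Equivalent v w → Equivalent u w := by
  induction n with
  | zero =>
    intro u v w hu h1 h2
    have e1 := h1.length_eq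
    have e2 := h2.length_eq
    obtain rfl : u = [] := List.length_eq_zero_iff.1 (by omega)
    obtain rfl : w = [] := List.length_eq_zero_iff.1 (by simp_all)
    exact nil
  | succ n ih =>
    intro u v w hu h1 h2
    cases h1 with
    | nil => exact h2
    | @cons t u v h1 =>
      have hl := h1.length_eq
      simp only [List.length_cons] at hu
      generalize hx : t :: v = x at h2
      cases h2 with
      | nil => simp at hx
      | @cons t' v' w h2 =>
        simp only [List.cons.injEq] at hx
        obtain ⟨rfl, rfl⟩ := hx
        exact (ih (by omega) h1 h2).cons _
      | @flip ε s k v' w y hk hb e1 e2 =>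
        simp only [List.cons.injEq] at hx
        obtain ⟨rfl, rfl⟩ := hx
        exact flip ε s hk hb (ih (by omega) h1 e1) e2
    | @flip ε s k u v y hk hb e1 e2 =>
      have hl1 := e1.length_eq
      have hl2 := e2.length_eq
      simp only [List.length_cons, length_walk] at hu hl1 hl2
      generalize hx : (nu (!ε))^[k + 2] (nu (!ε) (bar s)) :: v = x at h2
      cases h2 with
      | nil => simp at hx
      | @cons t' v' w h2 =>
        simp only [List.cons.injEq] at hx
        obtain ⟨rfl, rfl⟩ := hx
        exact flip ε s hk hb e1 (ih (by rw [← h2.length_eq]; omega) h2.symm e2)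
      | @flip δ s' k' v' w y' hk' hb' e3 e4 =>
        simp only [List.cons.injEq] at hx
        obtain ⟨hx, rfl⟩ := hx
        obtain rfl : k' = k := by omega
        -- Two flips in a row: the state of the middle word fixes the direction of its run, so both
        -- flips use the same polygon and the second undoes the first, up to equivalence of the
        -- bottoms `y` and `y'`.
        have hst := e2.stateOf_eq.symm.trans e3.stateOf_eq
        rw [hb.not.stateOf_walk (by omega), hb'.stateOf_walk (by omega)] at hst
        simp only [run.injEq] at hst
        obtain rfl : δ = !ε := hst.1.symm
        obtain rfl := (nu_injective _).iterate _ hx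
        have hy : Equivalent y y' := (ih (by simp; omega) e2.symm e3).of_walk
        have h5 := ih (by omega) e1 (hy.walk ε s (k' + 2))
        simp only [Bool.not_not, nu_bar_nu_not, bar_bar] at e4 ⊢
        exact (ih (by omega) h5 e4.symm).cons _

theorem trans {u v w : List (Letter g)} (h1 : Equivalent u v) (h2 : Equivalent v w) :
    Equivalent u w := trans_of_length _ le_rfl h1 h2

end Equivalent

theorem ConeState.Flat.isDown {ε : Bool} {s : Letter g} {q : ConeState g} (h : Flat ε s q) :
    q.IsDown (bar s) := by
  rcases h with rfl | ⟨l, rfl⟩ | rfl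
  · rfl
  · rfl
  · rw [isDown_mkTop]; exact Or.inl rfl

/-- Inverts `step`: a run prolongs a run, or starts with length 2 after a flat edge. -/
theorem ConeState.eq_run_of_step {ε : Bool} {s u : Letter g} {q : ConeState g} {l : ℕ}
    (h : q.step s = run ε u l) : u = s ∧
    ((∃ p m, q = run ε p m ∧ s = nu ε p ∧ l = m + 1 ∧ l < 2 * g) ∨
      (l = 2 ∧ ∃ p, s = nu ε p ∧ Flat ε p q)) := by
  rcases q with _ | p | ⟨δ, p, m⟩ | p
  · simp [step] at h
  · simp only [step] at h
    split_ifs at h with h1 h2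
    · simp only [run.injEq] at h
      obtain ⟨rfl, rfl, rfl⟩ := h
      exact ⟨rfl, Or.inr ⟨rfl, p, h1, Or.inl rfl⟩⟩
    · simp only [run.injEq] at h
      obtain ⟨rfl, rfl, rfl⟩ := h
      exact ⟨rfl, Or.inr ⟨rfl, p, h2, Or.inl rfl⟩⟩
  · simp only [step] at h
    split_ifs at h with h1 h2 h3
    · simp only [run.injEq] at h
      obtain ⟨rfl, rfl, rfl⟩ := h
      exact ⟨rfl, Or.inl ⟨p, m, rfl, h1, rfl, h2⟩⟩
    · simp [mkTop] at h
    · simp only [run.injEq] at h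
      obtain ⟨rfl, rfl, rfl⟩ := h
      exact ⟨rfl, Or.inr ⟨rfl, p, h3, Or.inr (Or.inl ⟨m, by simp⟩)⟩⟩
  · simp only [step] at h
    split_ifs at h with h1 h2
    · simp only [run.injEq] at h
      obtain ⟨rfl, rfl, rfl⟩ := h
      exact ⟨rfl, Or.inr ⟨rfl, p, h1, Or.inr (Or.inr (by simp [mkTop]))⟩⟩
    · simp only [run.injEq] at h
      obtain ⟨rfl, rfl, rfl⟩ := h
      exact ⟨rfl, Or.inr ⟨rfl, _, h2, Or.inr (Or.inr (by simp [mkTop]))⟩⟩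

theorem ConeState.isDown_step {s t : Letter g} {q : ConeState g} (h : (q.step s).IsDown t) :
    t = bar s ∨ ∃ ε u l, q = run ε u l ∧ s = nu ε u ∧ 2 * g ≤ l + 1 ∧ t = nu ε s := by
  rcases q with _ | p | ⟨δ, p, m⟩ | p
  · exact Or.inl h
  · simp only [step] at h
    split_ifs at h <;> exact Or.inl h
  · simp only [step] at h
    split_ifs at h with h1 h2 h3
    · exact Or.inl h
    · rw [isDown_mkTop] at h
      exact h.imp_right fun h => ⟨δ, p, m, rfl, h1, by omega, h⟩
    · exact Or.inl h
    · exact Or.inl h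
  · simp only [step] at h
    split_ifs at h <;> exact Or.inl h

/-- Every downward letter is the inverse of the last letter of an equivalent word, and every run
comes from a walk that starts at the bottom of a polygon. -/
theorem exists_equivalent_aux (hg : 2 ≤ g) (w : List (Letter g)) : ∀ _ : Accepted w,
    (∀ ε s l, stateOf w = run ε s l → ∃ k u y, l = k + 2 ∧ k + 2 < 2 * g ∧
      IsBottom ε u (stateOf y) ∧ Equivalent w (walk ε u y (k + 2))) ∧
    (∀ t, (stateOf w).IsDown t → ∃ v, Equivalent w (bar t :: v)) := by
  induction w with
  | nil =>
    refine fun _ => ⟨fun ε s l h => ?_, fun t h => ?_⟩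
    · simp [stateOf] at h
    · simp [stateOf, IsDown] at h
  | cons s w ih =>
    intro hw
    -- The claims need each other: a new run must choose the word below so that it ends in the right
    -- letter, and the second way down from a top needs the walk behind the run.
    obtain ⟨ihR, ihD⟩ := ih hw.1
    refine ⟨fun ε s' l h => ?_, fun t h => ?_⟩
    · obtain ⟨rfl, ⟨p, m, h1, rfl, rfl, h2⟩ | ⟨rfl, p, rfl, hp⟩⟩ := eq_run_of_step h
      · obtain ⟨k, u, y, rfl, hk, hb, he⟩ := ihR _ _ _ h1
        refine ⟨k + 1, u, y, rfl, h2, hb, ?_⟩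
        have h3 := he.stateOf_eq
        rw [h1, hb.stateOf_walk hk] at h3
        simp only [run.injEq] at h3
        obtain rfl := h3.2.1
        rw [← Function.iterate_succ_apply' (nu ε)]
        exact he.cons _
      · obtain ⟨v, hv⟩ := ihD _ hp.isDown
        rw [bar_bar] at hv
        refine ⟨0, p, v, rfl, by omega, ?_, hv.cons _⟩
        apply isBottom_of_flat (hv.accepted_iff.1 hw.1).2
        rw [hv.stateOf_eq] at hp
        exact hp
    · rcases isDown_step h with rfl | ⟨ε, p, l, h1, rfl, h2, rfl⟩
      · exact ⟨w, by rw [bar_bar]; exact Equivalent.refl _⟩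
      · obtain ⟨k, u, y, rfl, hk, hb, he⟩ := ihR _ _ _ h1
        have h3 := he.stateOf_eq
        rw [h1, hb.stateOf_walk hk] at h3
        simp only [run.injEq] at h3
        obtain rfl := h3.2.1
        -- The run had length `2g - 1`, so `s` completes half the polygon, and flipping to the other
        -- half exhibits the second last letter.
        have hk' : k + 3 = 2 * g := by omega
        refine ⟨walk (!ε) (nu (!ε) (bar u)) y (k + 2), ?_⟩
        rw [← Function.iterate_succ_apply' (nu ε), ← iterate_not_eq_bar_nu hk']
        exact Equivalent.flip ε u hk' hb he (Equivalent.refl _)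

theorem exists_equivalent_cons (hg : 2 ≤ g) {w : List (Letter g)} (hw : Accepted w) {t : Letter g}
    (ht : (stateOf w).IsDown t) : ∃ v, Equivalent w (bar t :: v) :=
  (exists_equivalent_aux hg w hw).2 t ht

theorem run_length_lt (hg : 2 ≤ g) {w : List (Letter g)} (hw : Accepted w) {ε : Bool}
    {s : Letter g} {l : ℕ} (h : stateOf w = run ε s l) : 2 ≤ l ∧ l < 2 * g := by
  obtain ⟨k, u, y, rfl, hk, -⟩ := (exists_equivalent_aux hg w hw).1 ε s l h
  exact ⟨by omega, hk⟩

/-! ### Boundaries of polygons -/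

/-- The word of length `k` along a relator in direction `ε`, starting with `s`. -/
abbrev path (ε : Bool) (s : Letter g) (k : ℕ) : List (Letter g) := List.iterate (nu ε) s k

theorem path_succ (ε : Bool) (s : Letter g) (k : ℕ) :
    path ε s (k + 1) = path ε s k ++ [(nu ε)^[k] s] := by
  rw [path, List.iterate_add]; rfl

theorem path_succ' (ε : Bool) (s : Letter g) (k : ℕ) :
    path ε s (k + 1) = s :: path ε (nu ε s) k := rfl

theorem reverse_path (ε : Bool) (s : Letter g) (w : List (Letter g)) (k : ℕ) :
    (path ε s k).reverse ++ w = walk ε s w k := by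
  induction k with
  | zero => rfl
  | succ k ih => rw [path_succ, List.reverse_append, List.append_assoc, ih]; rfl

theorem invRev_path (ε : Bool) (s : Letter g) (k : ℕ) :
    FreeGroup.invRev (path (!ε) (nu (!ε) (bar s)) k) =
      path ε (bar ((nu (!ε))^[k] (bar s))) k := by
  induction k with
  | zero => rfl
  | succ k ih =>
    have h : nu ε (bar ((nu (!ε))^[k + 1] (bar s))) = bar ((nu (!ε))^[k] (bar s)) := by
      rw [Function.iterate_succ_apply', nu_bar_nu_not]
    rw [path_succ, FreeGroup.invRev_append, ih, path_succ', h]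
    rfl

theorem invRev_path_half (hg : 2 ≤ g) (ε : Bool) (s : Letter g) :
    FreeGroup.invRev (path (!ε) (nu (!ε) (bar s)) (2 * g)) =
      path ε ((nu ε)^[2 * g] s) (2 * g) := by
  obtain ⟨k, hk⟩ : ∃ k, k + 1 = 2 * g := ⟨2 * g - 1, by omega⟩
  rw [invRev_path, ← hk, Function.iterate_succ_apply, bar_iterate_eq_nu hk,
    Function.iterate_succ_apply']

/-- The boundary is one half followed by the inverse of the other, both read from the same corner.
-/
theorem path_full (hg : 2 ≤ g) (ε : Bool) (s : Letter g) :
    path ε s (4 * g) = path ε s (2 * g) ++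
      FreeGroup.invRev (path (!ε) (nu (!ε) (bar s)) (2 * g)) := by
  rw [invRev_path_half hg, path, show 4 * g = 2 * g + 2 * g by ring, List.iterate_add]

theorem flatMap_iterate_finRotate (i : Fin g) (k : ℕ) :
    ((List.iterate (finRotate g) i k).flatMap fun i =>
      [((Sum.inl i, true) : Letter g), (Sum.inr i, true), (Sum.inl i, false), (Sum.inr i, false)]) =
      path true (Sum.inl i, true) (4 * k) := by
  induction k generalizing i with
  | zero => rfl
  | succ k ih =>
    rw [List.iterate, List.flatMap_cons, ih, Nat.mul_succ, add_comm, path, path, List.iterate_add]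
    rfl

theorem relatorWord_eq_path (hg : 2 ≤ g) :
    relatorWord g = path true (Sum.inl (⟨0, by omega⟩ : Fin g), true) (4 * g) := by
  rw [← flatMap_iterate_finRotate, relatorWord]
  congr 1
  apply List.ext_getElem
  · simp
  · intro j h1 h2
    ext
    have : j < g := by simpa using h1
    rw [List.getElem_iterate, finRotate_iterate_val]
    simp [Nat.mod_eq_of_lt this]

theorem exists_iterate_eq (hg : 2 ≤ g) (s : Letter g) :
    ∃ k, (nu true)^[k] (Sum.inl (⟨0, by omega⟩ : Fin g), true) = s := by
  obtain ⟨i, k, hk⟩ := exists_nu_iterate true s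
  -- `4 * i` steps lead to `a_i`; by periodicity, `(4 * g - 1) * k` further steps amount to `k`
  -- steps back, to `s`.
  refine ⟨(4 * g - 1) * k + 4 * i, ?_⟩
  have hi : (finRotate g)^[(i : ℕ)] ⟨0, by omega⟩ = i := by
    ext
    simp [finRotate_iterate_val, Nat.mod_eq_of_lt i.2]
  rw [Function.iterate_add_apply, nu_true_iterate_four, hi, ← hk, ← Function.iterate_add_apply,
    ← Nat.succ_mul, Nat.succ_eq_add_one, Nat.sub_add_cancel (by omega), Function.iterate_mul,
    Function.iterate_fixed (nu_true_period s)]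

@[simp] theorem eval_append (v w : List (Letter g)) : eval (v ++ w) = eval v * eval w := by
  simp only [eval]
  rw [← FreeGroup.mul_mk, map_mul]

theorem eval_cons (t : Letter g) (w : List (Letter g)) : eval (t :: w) = eval [t] * eval w := by
  rw [← eval_append]; rfl

@[simp] theorem eval_nil : eval ([] : List (Letter g)) = 1 := map_one _

@[simp] theorem eval_invRev (w : List (Letter g)) : eval (FreeGroup.invRev w) = (eval w)⁻¹ := by
  simp only [eval]
  rw [← FreeGroup.inv_mk, map_inv]

theorem eval_relatorWord : eval (relatorWord g) = 1 := by
  rw [eval, mk_relatorWord]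
  exact PresentedGroup.one_of_mem rfl

/-- Rotating a closed word by one letter conjugates its value. -/
theorem eval_path_nu (ε : Bool) (s : Letter g) :
    eval (path ε (nu ε s) (4 * g)) = 1 ↔ eval (path ε s (4 * g)) = 1 := by
  rcases Nat.eq_zero_or_pos g with rfl | h
  · simp
  obtain ⟨k, hk⟩ : ∃ k, k + 1 = 4 * g := ⟨4 * g - 1, by omega⟩
  rw [← hk, path_succ _ (nu ε s), ← Function.iterate_succ_apply, Nat.succ_eq_add_one, path_succ',
    eval_append, eval_cons s, hk, nu_period]
  exact mul_eq_one_comm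

theorem eval_path_iterate (ε : Bool) (s : Letter g) (k : ℕ) :
    eval (path ε ((nu ε)^[k] s) (4 * g)) = 1 ↔ eval (path ε s (4 * g)) = 1 := by
  induction k with
  | zero => rfl
  | succ k ih => rw [Function.iterate_succ_apply', eval_path_nu, ih]

theorem eval_path_half (hg : 2 ≤ g) (ε : Bool) (s : Letter g) :
    eval (path ε s (2 * g)) = eval (path (!ε) (nu (!ε) (bar s)) (2 * g)) := by
  have key : ∀ s : Letter g,
      eval (path true s (2 * g)) = eval (path false (nu false (bar s)) (2 * g)) := by
    intro s
    have h : eval (path true s (4 * g)) = 1 := by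
      obtain ⟨k, rfl⟩ := exists_iterate_eq hg s
      rw [eval_path_iterate, ← relatorWord_eq_path hg, eval_relatorWord]
    rw [path_full hg, eval_append, eval_invRev, mul_inv_eq_one] at h
    exact h
  cases ε
  · have := key (nu true (bar s))
    simp only [nu_false_bar_nu_true, bar_bar] at this
    exact this.symm
  · exact key s

theorem Equivalent.eval_eq (hg : 2 ≤ g) {v w : List (Letter g)} (h : Equivalent v w) :
    eval v.reverse = eval w.reverse := by
  induction h with
  | nil => rfl
  | cons t _ ih => simp [ih]
  | @flip ε s k v w y hk hb h1 h2 ih1 ih2 =>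
    have h3 := eval_path_half hg ε s
    rw [← hk, path_succ, path_succ _ _ (k + 2)] at h3
    rw [List.reverse_cons, List.reverse_cons, eval_append, eval_append, ih1, ih2, ← eval_append,
      ← eval_append, ← reverse_path, ← reverse_path, List.reverse_append, List.reverse_append,
      List.reverse_reverse, List.reverse_reverse, List.append_assoc, List.append_assoc,
      eval_append y.reverse, h3, ← eval_append]

theorem ConeState.isDown_step_bar (q : ConeState g) (t : Letter g) : (q.step t).IsDown (bar t) := by
  rcases q with _ | p | ⟨δ, p, m⟩ | p
  · rfl
  · simp only [step]
    split_ifs <;> rfl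
  · simp only [step]
    split_ifs
    · rfl
    · rw [isDown_mkTop]; exact Or.inl rfl
    · rfl
    · rfl
  · simp only [step]
    split_ifs <;> rfl

/-! ### Vertices of the tessellation -/

/-- Equivalence of accepted words. -/
instance acceptedSetoid (g : ℕ) : Setoid {w : List (Letter g) // Accepted w} where
  r v w := Equivalent v.1 w.1
  iseqv := ⟨fun v => Equivalent.refl v.1, Equivalent.symm, Equivalent.trans⟩

/-- Vertices: classes of accepted words. -/
def Vertex (g : ℕ) : Type := Quotient (acceptedSetoid g)

namespace Vertex

/-- The vertex of an accepted word. -/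
def mk (w : List (Letter g)) (hw : Accepted w) : Vertex g := Quotient.mk _ ⟨w, hw⟩

theorem mk_eq_mk {v w : List (Letter g)} {hv : Accepted v} {hw : Accepted w} :
    mk v hv = mk w hw ↔ Equivalent v w := Quotient.eq

theorem ind {p : Vertex g → Prop} (h : ∀ w hw, p (mk w hw)) (v : Vertex g) : p v :=
  Quotient.ind (fun w => h w.1 w.2) v

/-- The state of a vertex. -/
def state : Vertex g → ConeState g := Quotient.lift (fun w => stateOf w.1) fun _ _ h => h.stateOf_eq

/-- The distance of a vertex from the base vertex. -/
def len : Vertex g → ℕ := Quotient.lift (fun w => w.1.length) fun _ _ h => h.length_eq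

@[simp] theorem state_mk (w : List (Letter g)) (hw : Accepted w) :
    (mk w hw).state = stateOf w := rfl

@[simp] theorem len_mk (w : List (Letter g)) (hw : Accepted w) : (mk w hw).len = w.length := rfl

/-- `Up v t v'`: the edge from `v` labelled `t` leads away from the base vertex, to `v'`. -/
def Up (v : Vertex g) (t : Letter g) (v' : Vertex g) : Prop :=
  ∃ w, ∃ h : Accepted (t :: w), v = mk w h.1 ∧ v' = mk (t :: w) h

theorem exists_up {v : Vertex g} {t : Letter g} (h : ¬ v.state.IsDown t) : ∃ v', Up v t v' := by
  induction v using ind with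
  | h w hw => exact ⟨_, w, ⟨hw, h⟩, rfl, rfl⟩

theorem exists_up_bar (hg : 2 ≤ g) {v : Vertex g} {t : Letter g} (h : v.state.IsDown t) :
    ∃ v', Up v' (bar t) v := by
  induction v using ind with
  | h w hw =>
    obtain ⟨u, hu⟩ := exists_equivalent_cons hg hw h
    exact ⟨_, u, hu.accepted_iff.1 hw, rfl, mk_eq_mk.2 hu⟩

namespace Up
variable {v v' u : Vertex g} {t : Letter g}

theorem not_isDown (h : Up v t v') : ¬ v.state.IsDown t := by
  obtain ⟨w, h, rfl, rfl⟩ := h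
  exact h.2

theorem state_eq (h : Up v t v') : v'.state = v.state.step t := by
  obtain ⟨w, h, rfl, rfl⟩ := h
  rfl

theorem len_eq (h : Up v t v') : v'.len = v.len + 1 := by
  obtain ⟨w, h, rfl, rfl⟩ := h
  rfl

theorem right_unique (h : Up v t v') (h' : Up v t u) : v' = u := by
  obtain ⟨w, h, rfl, rfl⟩ := h
  obtain ⟨w', h', e, rfl⟩ := h'
  rw [mk_eq_mk] at e ⊢
  exact e.cons t

theorem left_unique (h : Up v t u) (h' : Up v' t u) : v = v' := by
  obtain ⟨w, h, rfl, rfl⟩ := h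
  obtain ⟨w', h', rfl, e⟩ := h'
  rw [mk_eq_mk] at e ⊢
  exact e.of_cons

theorem isDown_bar (h : Up v t v') : v'.state.IsDown (bar t) := by
  rw [h.state_eq]
  exact isDown_step_bar _ _

end Up

theorem exists_move (hg : 2 ≤ g) (v : Vertex g) (t : Letter g) :
    ∃ v', Up v t v' ∨ Up v' (bar t) v := by
  by_cases h : v.state.IsDown t
  · exact (exists_up_bar hg h).imp fun _ => Or.inr
  · exact (exists_up h).imp fun _ => Or.inl

open Classical in
/-- The vertex at the other end of the edge labelled `t` that starts at `v`. -/
noncomputable def move (v : Vertex g) (t : Letter g) : Vertex g :=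
  -- The default `v` never occurs for `2 ≤ g`, by `exists_move`.
  if h : ∃ v', Up v t v' ∨ Up v' (bar t) v then h.choose else v

theorem up_or_up (hg : 2 ≤ g) (v : Vertex g) (t : Letter g) :
    Up v t (move v t) ∨ Up (move v t) (bar t) v := by
  have h := exists_move hg v t
  rw [move, dif_pos h]
  exact h.choose_spec

theorem move_eq_of_up (hg : 2 ≤ g) {v v' : Vertex g} {t : Letter g} (h : Up v t v') :
    move v t = v' := by
  rcases up_or_up hg v t with h' | h'
  · exact h'.right_unique h
  · have := h'.isDown_bar
    rw [bar_bar] at this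
    exact absurd this h.not_isDown

theorem move_eq_of_up_bar (hg : 2 ≤ g) {v v' : Vertex g} {t : Letter g} (h : Up v' (bar t) v) :
    move v t = v' := by
  rcases up_or_up hg v t with h' | h'
  · have := h.isDown_bar
    rw [bar_bar] at this
    exact absurd this h'.not_isDown
  · exact h'.left_unique h

theorem move_move_bar (hg : 2 ≤ g) (v : Vertex g) (t : Letter g) :
    move (move v t) (bar t) = v := by
  rcases up_or_up hg v t with h | h
  · exact move_eq_of_up_bar hg (by rwa [bar_bar])
  · exact move_eq_of_up hg h

theorem move_bar_move (hg : 2 ≤ g) (v : Vertex g) (t : Letter g) :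
    move (move v (bar t)) t = v := by
  simpa using move_move_bar hg v (bar t)

theorem len_move_of_isDown (hg : 2 ≤ g) {v : Vertex g} {t : Letter g} (h : v.state.IsDown t) :
    (move v t).len + 1 = v.len := by
  rcases up_or_up hg v t with h' | h'
  · exact absurd h h'.not_isDown
  · exact h'.len_eq.symm

theorem up_move (hg : 2 ≤ g) {v : Vertex g} {t : Letter g} (h : ¬ v.state.IsDown t) :
    Up v t (move v t) := by
  obtain ⟨v', h'⟩ := exists_up h
  rwa [move_eq_of_up hg h']

/-- The vertex reached from `v` by a word. -/
noncomputable def moves (v : Vertex g) (w : List (Letter g)) : Vertex g := w.foldl move v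

@[simp] theorem moves_nil (v : Vertex g) : moves v [] = v := rfl

@[simp] theorem moves_cons (v : Vertex g) (t : Letter g) (w : List (Letter g)) :
    moves v (t :: w) = moves (move v t) w := rfl

@[simp] theorem moves_append (v : Vertex g) (u w : List (Letter g)) :
    moves v (u ++ w) = moves (moves v u) w := List.foldl_append

theorem moves_moves_invRev (hg : 2 ≤ g) (v : Vertex g) (w : List (Letter g)) :
    moves (moves v w) (FreeGroup.invRev w) = v := by
  induction w generalizing v with
  | nil => rfl
  | cons t w ih =>
    rw [FreeGroup.invRev_cons, moves_append, moves_cons, ih]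
    exact move_move_bar hg v t

theorem moves_mk (hg : 2 ≤ g) {w : List (Letter g)} (u : List (Letter g))
    (h : Accepted (u.reverse ++ w)) (hw : Accepted w) :
    moves (mk w hw) u = mk (u.reverse ++ w) h := by
  induction u generalizing w with
  | nil => rfl
  | cons t u ih =>
    have h' : Accepted (u.reverse ++ (t :: w)) := by simpa using h
    have ht : Accepted (t :: w) := by
      clear ih h
      generalize u.reverse = r at h'
      induction r with
      | nil => exact h'
      | cons a r ih => exact ih h'.1
    rw [moves_cons, move_eq_of_up hg ⟨w, ht, rfl, rfl⟩, ih h' ht]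
    simp

theorem moves_path_half (hg : 2 ≤ g) {v : Vertex g} {ε : Bool} {s : Letter g}
    (h : IsBottom ε s v.state) :
    moves v (path ε s (2 * g)) = moves v (path (!ε) (nu (!ε) (bar s)) (2 * g)) := by
  induction v using ind with
  | h w hw =>
    have h1 := h.accepted_walk hw le_rfl
    have h2 := h.not.accepted_walk hw le_rfl
    rw [← reverse_path] at h1 h2
    rw [moves_mk hg _ h1, moves_mk hg _ h2, mk_eq_mk, reverse_path, reverse_path]
    obtain ⟨k, hk⟩ : ∃ k, k + 3 = 2 * g := ⟨2 * g - 3, by omega⟩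
    rw [← hk]
    exact Equivalent.flip ε s hk h (Equivalent.refl _) (Equivalent.refl _)

/-- The polygons close up. -/
theorem moves_path_full (hg : 2 ≤ g) (ε : Bool) (v : Vertex g) (s : Letter g) :
    moves v (path ε s (4 * g)) = v := by
  obtain ⟨n, hn⟩ : ∃ n, n = v.len := ⟨_, rfl⟩
  induction n using Nat.strong_induction_on generalizing v s with
  | _ n ih =>
    obtain ⟨k, hk⟩ : ∃ k, k + 1 = 4 * g := ⟨4 * g - 1, by omega⟩
    have hs : (nu ε)^[k] (nu ε s) = s := by
      rw [← Function.iterate_succ_apply, Nat.succ_eq_add_one, hk, nu_period]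
    -- If either boundary edge at `v` leads down, the loop is conjugated to start at that lower
    -- neighbour, where induction applies.
    by_cases h1 : v.state.IsDown s
    · have h := ih _ (by have := len_move_of_isDown hg h1; omega) (move v s) (nu ε s) rfl
      rw [← hk, path_succ, hs, moves_append] at h
      rw [← hk, path_succ', moves_cons]
      have := congrArg (fun x => move x (bar s)) h
      simpa [move_move_bar hg] using this
    · by_cases h2 : v.state.IsDown (nu (!ε) (bar s))
      · have hc : nu ε (bar (nu (!ε) (bar s))) = s := by simp
        have hk2 : (nu ε)^[k] s = bar (nu (!ε) (bar s)) := by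
          apply nu_injective ε
          rw [hc, ← Function.iterate_succ_apply' (nu ε), Nat.succ_eq_add_one, hk, nu_period]
        generalize nu (!ε) (bar s) = c at h2 hc hk2
        have h := ih _ (by have := len_move_of_isDown hg h2; omega) (move v c) (bar c) rfl
        rw [← hk, path_succ', moves_cons, move_move_bar hg, hc] at h
        rw [← hk, path_succ, moves_append, h, hk2]
        exact move_move_bar hg v c
      -- Now `v` is the bottom, and the two halves reach the same vertex by a flip.
      · rw [path_full hg, moves_append, moves_path_half hg ⟨h1, h2⟩, moves_moves_invRev hg]

end Vertex

/-! ### Languages of the states -/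

namespace ConeState

/-- The words along which the automaton moves away from the identity. -/
def Accepts : ConeState g → List (Letter g) → Prop
  | _, [] => True
  | q, t :: w => ¬ q.IsDown t ∧ (q.step t).Accepts w

theorem Accepts.isReduced {q : ConeState g} {w : List (Letter g)} (h : q.Accepts w) :
    FreeGroup.IsReduced w := by
  induction w generalizing q with
  | nil => exact List.isChain_nil
  | cons t w ih =>
    rcases w with _ | ⟨u, w⟩
    · exact List.isChain_singleton _
    · refine List.isChain_cons_cons.2 ⟨fun h1 => ?_, ih h.2⟩
      by_contra h2
      refine h.2.1 ?_
      obtain rfl : u = bar t := Prod.ext h1.symm (by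
        change u.2 = !t.2
        rcases t with ⟨_, _ | _⟩ <;> rcases u with ⟨_, _ | _⟩ <;> simp_all)
      exact isDown_step_bar _ _

/-- The run can be prolonged exactly to the top, where the next boundary edge leads down. This makes
`l` visible in the language. -/
theorem accepts_run (ε : Bool) (s : Letter g) {l : ℕ} (hl : l < 2 * g) (k : ℕ) :
    (run ε s l).Accepts (path ε (nu ε s) k) ↔ l + k ≤ 2 * g := by
  induction k generalizing s l with
  | zero => simp [Accepts]; omega
  | succ k ih =>
    rw [path_succ', Accepts, step, if_pos rfl]
    have h1 : ¬ (run ε s l).IsDown (nu ε s) := nu_ne_bar ε s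
    simp only [h1, not_false_eq_true, true_and]
    split_ifs with h2
    · rw [ih _ h2]; omega
    · rcases k with _ | k
      · simp [Accepts]; omega
      · rw [path_succ', Accepts, isDown_mkTop]
        simp
        omega

theorem Flat.accepts (hg : 2 ≤ g) {ε : Bool} {s : Letter g} {q : ConeState g} (h : Flat ε s q)
    (k : ℕ) : q.Accepts (path ε (nu ε s) k) ↔ k + 1 ≤ 2 * g := by
  rcases k with _ | k
  · simp [Accepts]; omega
  · rw [path_succ', Accepts, h.step_nu, accepts_run _ _ (by omega)]
    simp only [h.not_isDown_nu, not_false_eq_true, true_and]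
    omega

/-- The states that occur, other than `start`. -/
def IsProper : ConeState g → Prop
  | start => False
  | run _ _ l => 2 ≤ l ∧ l < 2 * g
  | _ => True

theorem not_accepts_of_run {ε : Bool} {s : Letter g} {l : ℕ} (hg : 2 ≤ g)
    (hl : 2 ≤ l ∧ l < 2 * g) {q : ConeState g} (h : Flat ε s q)
    (he : ∀ w, q.Accepts w ↔ (run ε s l).Accepts w) : False := by
  -- After a flat edge `2g - 1` letters of the polygon remain; after a run of length at least 2,
  -- fewer do.
  have := he (path ε (nu ε s) (2 * g - 1))
  rw [h.accepts hg, accepts_run _ _ hl.2] at this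
  omega

/-- One-letter words reveal the downward letters: none for `start`, one for `one` and `run`, two for
`top`. These give `s`; then words along the two polygons at `s` give the direction and length of a
run. -/
theorem eq_of_accepts_iff (hg : 2 ≤ g) {p q : ConeState g} (hp : p.IsProper ∨ p = start)
    (hq : q.IsProper ∨ q = start) (h : ∀ w, p.Accepts w ↔ q.Accepts w) : p = q := by
  have hd : ∀ t, p.IsDown t ↔ q.IsDown t := fun t => by
    simpa [Accepts, not_iff_not] using h [t]
  rcases p with _ | s | ⟨ε, s, l⟩ | s <;> rcases q with _ | t | ⟨δ, t, m⟩ | t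
  · rfl
  · exact absurd ((hd (bar t)).2 rfl) id
  · exact absurd ((hd (bar t)).2 rfl) id
  · exact absurd ((hd (bar t)).2 (Or.inl rfl)) id
  · exact absurd ((hd (bar s)).1 rfl) id
  · obtain rfl := bar_injective ((hd (bar s)).1 rfl)
    rfl
  · obtain rfl := bar_injective ((hd (bar s)).1 rfl)
    exact (not_accepts_of_run hg (by simpa [IsProper] using hq) (Or.inl rfl) h).elim
  · have h1 := (hd (bar t)).2 (Or.inl rfl)
    have h2 := (hd (nu true t)).2 (Or.inr rfl)
    exact absurd (h2.trans h1.symm) (nu_ne_bar _ _)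
  · exact absurd ((hd (bar s)).1 rfl) id
  · obtain rfl := bar_injective ((hd (bar s)).1 rfl)
    exact (not_accepts_of_run hg (by simpa [IsProper] using hp) (Or.inl rfl)
      fun w => (h w).symm).elim
  · obtain rfl := bar_injective ((hd (bar s)).1 rfl)
    simp only [IsProper, reduceCtorEq, or_false] at hp hq
    by_cases hε : ε = δ
    · subst hε
      have h1 := h (path ε (nu ε s) (2 * g - l))
      have h2 := h (path ε (nu ε s) (2 * g - m))
      rw [accepts_run _ _ hp.2, accepts_run _ _ hq.2] at h1 h2
      obtain rfl : l = m := by omega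
      rfl
    · obtain rfl : ε = !δ := by cases ε <;> cases δ <;> simp_all
      exact (not_accepts_of_run hg hq (Or.inr (Or.inl ⟨l, rfl⟩)) h).elim
  · have h1 := (hd (bar t)).2 (Or.inl rfl)
    have h2 := (hd (nu true t)).2 (Or.inr rfl)
    exact absurd (h2.trans h1.symm) (nu_ne_bar _ _)
  · exact absurd ((hd (bar s)).1 (Or.inl rfl)) id
  · have h1 := (hd (bar s)).1 (Or.inl rfl)
    have h2 := (hd (nu true s)).1 (Or.inr rfl)
    exact absurd (h2.trans h1.symm) (nu_ne_bar _ _)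
  · have h1 := (hd (bar s)).1 (Or.inl rfl)
    have h2 := (hd (nu true s)).1 (Or.inr rfl)
    exact absurd (h2.trans h1.symm) (nu_ne_bar _ _)
  · rcases (hd (bar s)).1 (Or.inl rfl) with h1 | h1
    · rw [bar_inj.1 h1]
    · rcases (hd (bar t)).2 (Or.inl rfl) with h2 | h2
      · rw [bar_inj.1 h2]
      -- Two tops could also share their downward pair with the roles exchanged, but then two turns
      -- about the vertex would return to the start.
      · have h3 := nu_bar_nu_ne_bar true s
        rw [← h2, bar_bar] at h3
        exact absurd h1.symm h3

/-- The reduced words accepted from a state. -/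
def language (q : ConeState g) : Set (FreeGroup (Gen g)) := {z | q.Accepts z.toWord}

theorem eq_of_language_eq (hg : 2 ≤ g) {p q : ConeState g} (hp : p.IsProper ∨ p = start)
    (hq : q.IsProper ∨ q = start) (h : p.language = q.language) : p = q := by
  refine eq_of_accepts_iff hg hp hq fun w => ?_
  have key : FreeGroup.IsReduced w → (p.Accepts w ↔ q.Accepts w) := fun hw => by
    have := Set.ext_iff.1 h (FreeGroup.mk w)
    simpa only [language, Set.mem_ofPred_eq, FreeGroup.toWord_mk, hw.reduce_eq] using this
  exact ⟨fun h => (key h.isReduced).1 h, fun h => (key h.isReduced).2 h⟩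

/-- With `4g` letters: `4g + 2 · 4g · (2g - 2) + 4g = 8g(2g - 1)`. -/
theorem encard_isProper (hg : 2 ≤ g) :
    {q : ConeState g | q.IsProper}.encard = ((8 * g * (2 * g - 1) : ℕ) : ℕ∞) := by
  let f : Letter g ⊕ (Bool × Letter g × Fin (2 * g - 2)) ⊕ Letter g → ConeState g
    | Sum.inl s => one s
    | Sum.inr (Sum.inl (ε, s, l)) => run ε s (l + 2)
    | Sum.inr (Sum.inr s) => top s
  have hf : Function.Injective f := by
    rintro (s | ⟨ε, s, l⟩ | s) (t | ⟨δ, t, m⟩ | t) h <;> simp_all [f, Fin.ext_iff]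
  have hr : {q : ConeState g | q.IsProper} = Set.range f := by
    ext q
    constructor
    · intro hq
      rcases q with _ | s | ⟨ε, s, l⟩ | s
      · exact hq.elim
      · exact ⟨Sum.inl s, rfl⟩
      · obtain ⟨h1, h2⟩ : 2 ≤ l ∧ l < 2 * g := hq
        refine ⟨Sum.inr (Sum.inl (ε, s, ⟨l - 2, by omega⟩)), ?_⟩
        simp only [f, Nat.sub_add_cancel h1]
      · exact ⟨Sum.inr (Sum.inr s), rfl⟩
    · rintro ⟨s | ⟨ε, s, l⟩ | s, rfl⟩
      · trivial
      · have := l.2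
        exact ⟨by omega, by omega⟩
      · trivial
  rw [hr, ← Set.image_univ, hf.encard_image, Set.encard_univ, ENat.card_eq_coe_fintype_card]
  congr 1
  simp only [Fintype.card_sum, Fintype.card_prod, Fintype.card_bool, Fintype.card_fin]
  obtain ⟨m, rfl⟩ : ∃ m, g = m + 1 := ⟨g - 1, by omega⟩
  rw [show 2 * (m + 1) - 2 = 2 * m by omega, show 2 * (m + 1) - 1 = 2 * m + 1 by omega]
  ring

end ConeState

theorem accepted_nil : Accepted ([] : List (Letter g)) := trivial

/-! ### The action of the surface group -/

namespace Vertex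

/-- The permutation of the vertices given by a letter. -/
noncomputable def movePerm (hg : 2 ≤ g) (t : Letter g) : Equiv.Perm (Vertex g) where
  toFun v := move v t
  invFun v := move v (bar t)
  left_inv v := move_move_bar hg v t
  right_inv v := move_bar_move hg v t

/-- Words move a vertex by their first letter first, whereas permutations compose from the right;
hence the opposite group. -/
theorem lift_movePerm (hg : 2 ≤ g) (w : List (Letter g)) (v : Vertex g) :
    (FreeGroup.lift (fun x : Gen g => MulOpposite.op (movePerm hg (x, true)))
      (FreeGroup.mk w)).unop v = moves v w := by
  induction w generalizing v with
  | nil => rfl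
  | cons t w ih =>
    rw [← List.singleton_append, ← FreeGroup.mul_mk, map_mul, MulOpposite.unop_mul,
      Equiv.Perm.mul_apply, ih]
    rcases t with ⟨x, _ | _⟩ <;> simp [FreeGroup.lift_mk] <;> rfl

/-- The right action of the surface group on the vertices. -/
noncomputable def action (hg : 2 ≤ g) : SurfaceGroup g →* (Equiv.Perm (Vertex g))ᵐᵒᵖ :=
  PresentedGroup.toGroup (f := fun x : Gen g => MulOpposite.op (movePerm hg (x, true))) (by
    rintro r rfl
    apply MulOpposite.unop_injective
    ext v
    rw [← mk_relatorWord, lift_movePerm, relatorWord_eq_path hg, moves_path_full hg]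
    rfl)

theorem action_eval (hg : 2 ≤ g) (w : List (Letter g)) (v : Vertex g) :
    (action hg (eval w)).unop v = moves v w := lift_movePerm hg w v

/-- The vertex of a group element. -/
noncomputable def ofGroup (hg : 2 ≤ g) (x : SurfaceGroup g) : Vertex g :=
  (action hg x).unop (mk [] accepted_nil)

theorem ofGroup_mul_eval (hg : 2 ≤ g) (x : SurfaceGroup g) (w : List (Letter g)) :
    ofGroup hg (x * eval w) = moves (ofGroup hg x) w := by
  rw [ofGroup, map_mul, MulOpposite.unop_mul, Equiv.Perm.mul_apply, action_eval]
  rfl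

theorem ofGroup_one (hg : 2 ≤ g) : ofGroup hg 1 = mk [] accepted_nil := by
  simp [ofGroup]

theorem ofGroup_eval (hg : 2 ≤ g) {w : List (Letter g)} (hw : Accepted w) :
    ofGroup hg (eval w.reverse) = mk w hw := by
  have hw' : Accepted (w.reverse.reverse ++ []) := by simpa using hw
  rw [← one_mul (eval w.reverse), ofGroup_mul_eval, ofGroup_one, moves_mk hg _ hw']
  simp

/-- The group element of a vertex. -/
def toGroup (hg : 2 ≤ g) : Vertex g → SurfaceGroup g :=
  Quotient.lift (fun w => eval w.1.reverse) fun _ _ h => Equivalent.eval_eq hg h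

theorem toGroup_move (hg : 2 ≤ g) (v : Vertex g) (t : Letter g) :
    toGroup hg (move v t) = toGroup hg v * eval [t] := by
  have key : ∀ {u u' : Vertex g} {t : Letter g}, Up u t u' →
      toGroup hg u' = toGroup hg u * eval [t] := by
    rintro _ _ t ⟨w, h, rfl, rfl⟩
    change eval (t :: w).reverse = eval w.reverse * eval [t]
    simp
  rcases up_or_up hg v t with h | h
  · exact key h
  · rw [key h, mul_assoc, ← eval_append]
    have : eval [bar t, t] = 1 := by
      rw [eval_cons, show [bar t] = FreeGroup.invRev [t] from rfl, eval_invRev, inv_mul_cancel]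
    simp [this]

theorem toGroup_moves (hg : 2 ≤ g) (v : Vertex g) (w : List (Letter g)) :
    toGroup hg (moves v w) = toGroup hg v * eval w := by
  induction w generalizing v with
  | nil => simp
  | cons t w ih => rw [moves_cons, ih, toGroup_move, eval_cons t w, mul_assoc]

theorem exists_eval_eq (x : SurfaceGroup g) : ∃ w, eval w = x := by
  obtain ⟨z, rfl⟩ := PresentedGroup.mk_surjective _ x
  exact ⟨z.toWord, by rw [eval, FreeGroup.mk_toWord]⟩

theorem toGroup_ofGroup (hg : 2 ≤ g) (x : SurfaceGroup g) : toGroup hg (ofGroup hg x) = x := by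
  obtain ⟨w, rfl⟩ := exists_eval_eq x
  rw [← one_mul (eval w), ofGroup_mul_eval, toGroup_moves, ofGroup_one]
  congr 1

theorem len_move_le (hg : 2 ≤ g) (v : Vertex g) (t : Letter g) : (move v t).len ≤ v.len + 1 := by
  rcases up_or_up hg v t with h | h <;> have := h.len_eq <;> omega

theorem len_moves_le (hg : 2 ≤ g) (v : Vertex g) (w : List (Letter g)) :
    (moves v w).len ≤ v.len + w.length := by
  induction w generalizing v with
  | nil => simp
  | cons t w ih =>
    have h1 := ih (move v t)
    have h2 := len_move_le hg v t
    simp only [moves_cons, List.length_cons]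
    omega

/-- A letter gains at most one, so the full gain requires every letter to lead up. -/
theorem len_moves_eq_iff (hg : 2 ≤ g) (v : Vertex g) (w : List (Letter g)) :
    (moves v w).len = v.len + w.length ↔ v.state.Accepts w := by
  induction w generalizing v with
  | nil => simp [Accepts]
  | cons t w ih =>
    rw [Accepts, moves_cons, List.length_cons]
    by_cases h : v.state.IsDown t
    · have h1 := len_move_of_isDown hg h
      have h2 := len_moves_le hg (move v t) w
      simp only [h, not_true_eq_false, false_and, iff_false]
      omega
    · have h1 := up_move hg h
      have h2 := h1.len_eq
      rw [← h1.state_eq, ← ih, h2]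
      simp only [h, not_false_eq_true, true_and]
      omega

end Vertex

/-! ### The word metric and cone types -/

theorem dist_mul_eval_le (x : SurfaceGroup g) (w : List (Letter g)) : d x (x * eval w) ≤ w.length := by
  induction w generalizing x with
  | nil => simp [d]
  | cons t w ih =>
    have h1 : d x (x * eval [t]) ≤ 1 := by
      by_cases h : x = x * eval [t]
      · rw [← h]; simp [d]
      · refine (SimpleGraph.dist_eq_one_iff_adj.2 ?_).le
        refine (SimpleGraph.mulCayley_adj' _ _ _).2 ⟨h, PresentedGroup.of t.1, ⟨t.1, rfl⟩, ?_⟩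
        rcases t with ⟨a, _ | _⟩
        · right
          rw [show [((a, false) : Letter g)] = FreeGroup.invRev [(a, true)] from rfl, eval_invRev]
          exact (inv_mul_cancel_right _ _).symm
        · exact Or.inl rfl
    have h2 := ih (x * eval [t])
    have h3 : d x (x * eval [t] * eval w) ≤ _ := (cayleyGraph_connected g).dist_triangle
      (v := x * eval [t])
    rw [eval_cons, ← mul_assoc, List.length_cons]
    refine h3.trans ?_
    rw [add_comm]
    exact add_le_add h2 h1

theorem len_le_of_walk (hg : 2 ≤ g) {x y : SurfaceGroup g} (p : (cayleyGraph g).Walk x y) :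
    (Vertex.ofGroup hg y).len ≤ (Vertex.ofGroup hg x).len + p.length := by
  induction p with
  | nil => simp
  | @cons x y z h p ih =>
    have : (Vertex.ofGroup hg y).len ≤ (Vertex.ofGroup hg x).len + 1 := by
      obtain ⟨_, _, ⟨a, rfl⟩, h | h⟩ := (SimpleGraph.mulCayley_adj' _ _ _).1 h
      · have h1 : y = x * eval [((a, true) : Letter g)] := h.symm
        rw [h1, Vertex.ofGroup_mul_eval]
        exact Vertex.len_move_le hg _ _
      · have h1 : y = x * eval [((a, false) : Letter g)] := by
          rw [show [((a, false) : Letter g)] = FreeGroup.invRev [(a, true)] from rfl, eval_invRev]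
          exact eq_mul_inv_of_mul_eq h.symm
        rw [h1, Vertex.ofGroup_mul_eval]
        exact Vertex.len_move_le hg _ _
    rw [SimpleGraph.Walk.length_cons]
    omega

/-- The word metric is the length of the accepted words. -/
theorem dist_one_eq_len (hg : 2 ≤ g) (x : SurfaceGroup g) : d 1 x = (Vertex.ofGroup hg x).len := by
  apply le_antisymm
  · conv_lhs => rw [← Vertex.toGroup_ofGroup hg x]
    induction Vertex.ofGroup hg x using Vertex.ind with
    | h w hw =>
      have := dist_mul_eval_le 1 w.reverse
      rwa [one_mul, List.length_reverse] at this
  · obtain ⟨p, hp⟩ := (cayleyGraph_connected g).exists_walk_length_eq_dist 1 x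
    have := len_le_of_walk hg p
    rw [hp, Vertex.ofGroup_one, Vertex.len_mk, List.length_nil, zero_add] at this
    exact this

/-- The state of a group element. -/
noncomputable def coneState (hg : 2 ≤ g) (x : SurfaceGroup g) : ConeState g :=
  (Vertex.ofGroup hg x).state

theorem coneType_eq_language (hg : 2 ≤ g) (x : SurfaceGroup g) :
    coneType x = (coneState hg x).language := by
  ext z
  have hz : proj g z = eval z.toWord := by rw [eval, FreeGroup.mk_toWord]
  rw [coneType, Set.mem_ofPred_eq, hz, dist_one_eq_len hg, dist_one_eq_len hg,
    Vertex.ofGroup_mul_eval]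
  exact Vertex.len_moves_eq_iff hg _ _

theorem isProper_coneState (hg : 2 ≤ g) (x : SurfaceGroup g) :
    (coneState hg x).IsProper ∨ coneState hg x = start := by
  rw [coneState]
  induction Vertex.ofGroup hg x using Vertex.ind with
  | h w hw =>
    rw [Vertex.state_mk]
    generalize hq : stateOf w = q
    rcases q with _ | s | ⟨ε, s, l⟩ | s
    · exact Or.inr rfl
    · exact Or.inl trivial
    · exact Or.inl (run_length_lt hg hw hq)
    · exact Or.inl trivial

theorem coneState_one (hg : 2 ≤ g) : coneState hg 1 = start := by
  rw [coneState, Vertex.ofGroup_one]; rfl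

theorem coneType_eq_iff (hg : 2 ≤ g) {x y : SurfaceGroup g} :
    coneType x = coneType y ↔ coneState hg x = coneState hg y := by
  refine ⟨fun h => ?_, fun h => by rw [coneType_eq_language hg, h, ← coneType_eq_language hg]⟩
  rw [coneType_eq_language hg, coneType_eq_language hg] at h
  exact eq_of_language_eq hg (isProper_coneState hg x) (isProper_coneState hg y) h

/-! ### Short subwords of the relator -/

theorem accepted_path (ε : Bool) (s : Letter g) {k : ℕ} (hk : k ≤ 2 * g) :
    Accepted (walk ε s [] k) :=
  -- Nothing leads down from `start`, so the identity is the bottom at each of its corners.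
  ConeState.IsBottom.accepted_walk ⟨id, id⟩ accepted_nil hk

theorem ofGroup_eval_path (hg : 2 ≤ g) (ε : Bool) (s : Letter g) {k : ℕ} (hk : k ≤ 2 * g) :
    Vertex.ofGroup hg (eval (path ε s k)) = Vertex.mk _ (accepted_path ε s hk) := by
  rw [← Vertex.ofGroup_eval hg, ← reverse_path, List.append_nil, List.reverse_reverse]

theorem coneState_eval_path (hg : 2 ≤ g) (ε : Bool) (s : Letter g) {k : ℕ} (hk : k ≤ 2 * g) :
    coneState hg (eval (path ε s k)) = stateOf (walk ε s [] k) := by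
  rw [coneState, ofGroup_eval_path hg ε s hk, Vertex.state_mk]

theorem isGeodesicWord_path (hg : 2 ≤ g) (ε : Bool) (s : Letter g) {k : ℕ} (hk : k ≤ 2 * g) :
    IsGeodesicWord (path ε s k) := by
  rw [IsGeodesicWord, dist_one_eq_len hg, ofGroup_eval_path hg ε s hk]
  simp

theorem path_infix {ε : Bool} {s : Letter g} {n : ℕ} {w : List (Letter g)}
    (h : w <:+: path ε s n) : ∃ t, w = path ε t w.length := by
  obtain ⟨a, b, h⟩ := h
  refine ⟨(nu ε)^[a.length] s, ?_⟩
  have hn : n = a.length + (w.length + b.length) := by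
    have := congrArg List.length h
    simp at this
    omega
  rw [hn, path, List.iterate_add, List.iterate_add, List.append_assoc] at h
  have h1 := List.append_inj_right h (by simp)
  exact List.append_inj_left h1 (by simp)

theorem rotate_path (ε : Bool) (s : Letter g) (n : ℕ) :
    (path ε s (4 * g)).rotate n = path ε ((nu ε)^[n] s) (4 * g) := by
  rcases Nat.eq_zero_or_pos g with rfl | hg
  · simp
  obtain ⟨k, hk⟩ : ∃ k, k + 1 = 4 * g := ⟨4 * g - 1, by omega⟩
  induction n generalizing s with
  | zero => simp
  | succ n ih =>
    rw [Function.iterate_succ_apply, ← ih, add_comm, ← List.rotate_rotate]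
    congr 1
    rw [← hk, path_succ _ (nu ε s), ← Function.iterate_succ_apply, Nat.succ_eq_add_one, path_succ',
      hk, nu_period]
    simp

theorem invRev_relatorWord (hg : 2 ≤ g) :
    ∃ t, FreeGroup.invRev (relatorWord g) = path false t (4 * g) := by
  refine ⟨bar ((nu true)^[4 * g] (bar (nu false (bar (Sum.inl ⟨0, by omega⟩, true))))), ?_⟩
  rw [relatorWord_eq_path hg]
  simpa using invRev_path false (nu false (bar ((Sum.inl ⟨0, by omega⟩, true) : Letter g))) (4 * g)

theorem exists_nu_false_iterate_eq (hg : 2 ≤ g) (t s : Letter g) :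
    ∃ n, (nu false)^[n] t = s := by
  obtain ⟨i, hi⟩ := exists_iterate_eq hg (bar s)
  obtain ⟨j, hj⟩ := exists_iterate_eq hg (bar t)
  refine ⟨j + (4 * g - 1) * i, ?_⟩
  have h : (nu true)^[j + (4 * g - 1) * i] (bar s) = bar t := by
    rw [← hi, ← Function.iterate_add_apply, add_assoc, ← Nat.succ_mul, Nat.succ_eq_add_one,
      Nat.sub_add_cancel (by omega), Function.iterate_add_apply, Function.iterate_mul,
      Function.iterate_fixed (nu_true_period _), hj]
  have := nu_iterate_bar false (j + (4 * g - 1) * i) (bar s)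
  rwa [Bool.not_false, h, bar_bar, bar_bar] at this

/-- Rotations of the relator or its inverse are the closed paths in one direction, and `nu ε` is
transitive on letters, so every starting letter occurs. -/
theorem exists_isRotated_iff (hg : 2 ≤ g) {w : List (Letter g)} (hw : w.length ≤ 2 * g) :
    (∃ r : List (Letter g), (r ~r relatorWord g ∨ r ~r FreeGroup.invRev (relatorWord g)) ∧
      w <:+: r) ↔ ∃ ε s, w = path ε s w.length := by
  constructor
  · rintro ⟨r, hr | hr, h⟩
    · obtain ⟨n, rfl⟩ := hr.symm
      rw [relatorWord_eq_path hg, rotate_path] at h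
      exact ⟨true, path_infix h⟩
    · obtain ⟨n, rfl⟩ := hr.symm
      obtain ⟨t, ht⟩ := invRev_relatorWord hg
      rw [ht, rotate_path] at h
      exact ⟨false, path_infix h⟩
  · rintro ⟨ε, s, h⟩
    have hpre : w <:+: path ε s (4 * g) := by
      refine ⟨[], path ε ((nu ε)^[w.length] s) (4 * g - w.length), ?_⟩
      obtain ⟨m, hm⟩ : ∃ m, 4 * g = w.length + m := ⟨4 * g - w.length, by omega⟩
      rw [List.nil_append, hm, Nat.add_sub_cancel_left, path, path, List.iterate_add]
      exact congrArg (· ++ _) h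
    cases ε
    · obtain ⟨t, ht⟩ := invRev_relatorWord hg
      obtain ⟨n, hn⟩ := exists_nu_false_iterate_eq hg t s
      refine ⟨_, Or.inr (List.IsRotated.symm ⟨n, ?_⟩), hpre⟩
      rw [ht, rotate_path, hn]
    · obtain ⟨n, hn⟩ := exists_iterate_eq hg s
      refine ⟨_, Or.inl (List.IsRotated.symm ⟨n, ?_⟩), hpre⟩
      rw [relatorWord_eq_path hg, rotate_path, hn]

/-- Geodesicity is automatic here, by `isGeodesicWord_path`. -/
theorem mem_shortRelatorElements (hg : 2 ≤ g) {x : SurfaceGroup g} :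
    x ∈ shortRelatorElements g ↔ ∃ ε s k, k < 2 * g ∧ eval (path ε s (k + 1)) = x := by
  constructor
  · rintro ⟨w, ⟨h1, h2, h3, h4⟩, rfl⟩
    obtain ⟨ε, s, h⟩ := (exists_isRotated_iff hg h2).1 h4
    have := List.length_pos_iff.2 h1
    refine ⟨ε, s, w.length - 1, by omega, ?_⟩
    rw [Nat.sub_add_cancel (by omega), ← h]
  · rintro ⟨ε, s, k, hk, rfl⟩
    refine ⟨_, ⟨by simp, by simpa using hk, isGeodesicWord_path hg ε s hk, ?_⟩, rfl⟩
    exact (exists_isRotated_iff hg (by simpa using hk)).2 ⟨ε, s, by simp⟩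

theorem nu_iterate_surjective (ε : Bool) (k : ℕ) :
    Function.Surjective ((nu ε)^[k] : Letter g → Letter g) :=
  (Finite.injective_iff_surjective.1 (nu_injective ε)).iterate k

theorem coneState_eval_path_one (hg : 2 ≤ g) (ε : Bool) (s : Letter g) :
    coneState hg (eval (path ε s 1)) = one s :=
  coneState_eval_path hg ε s (by omega)

theorem coneState_eval_path_run (hg : 2 ≤ g) (ε : Bool) (s : Letter g) {k : ℕ}
    (hk : k + 2 < 2 * g) :
    coneState hg (eval (path ε s (k + 2))) = run ε ((nu ε)^[k + 1] s) (k + 2) := by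
  rw [coneState_eval_path hg ε s hk.le]
  exact ConeState.IsBottom.stateOf_walk ⟨id, id⟩ hk

theorem coneState_eval_path_top (hg : 2 ≤ g) (ε : Bool) (s : Letter g) {k : ℕ}
    (hk : k + 3 = 2 * g) :
    coneState hg (eval (path ε s (k + 3))) = mkTop ε ((nu ε)^[k + 2] s) := by
  rw [coneState_eval_path hg ε s hk.le]
  exact ConeState.IsBottom.stateOf_walk_top ⟨id, id⟩ hk

theorem exists_coneState_eq (hg : 2 ≤ g) {q : ConeState g} (hq : q.IsProper) :
    ∃ x ∈ shortRelatorElements g, coneState hg x = q := by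
  simp only [mem_shortRelatorElements hg]
  rcases q with _ | s | ⟨ε, s, l⟩ | s
  · exact hq.elim
  · exact ⟨_, ⟨true, s, 0, by omega, rfl⟩, coneState_eval_path_one hg true s⟩
  · obtain ⟨h1, h2⟩ : 2 ≤ l ∧ l < 2 * g := hq
    obtain ⟨k, rfl⟩ : ∃ k, l = k + 2 := ⟨l - 2, by omega⟩
    obtain ⟨t, rfl⟩ := nu_iterate_surjective ε (k + 1) s
    exact ⟨_, ⟨ε, t, k + 1, by omega, rfl⟩, coneState_eval_path_run hg ε t h2⟩
  · obtain ⟨k, hk⟩ : ∃ k, k + 3 = 2 * g := ⟨2 * g - 3, by omega⟩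
    obtain ⟨t, rfl⟩ := nu_iterate_surjective true (k + 2) s
    exact ⟨_, ⟨true, t, k + 2, by omega, rfl⟩, coneState_eval_path_top hg true t hk⟩

/-- A short relator element is determined by its state. -/
theorem coneState_injOn (hg : 2 ≤ g) : Set.InjOn (coneState hg) (shortRelatorElements g) := by
  obtain ⟨n, hn⟩ : ∃ n, n + 3 = 2 * g := ⟨2 * g - 3, by omega⟩
  -- A normal form that removes the coincidences: a single letter has no direction, and a half
  -- polygon in direction `false` equals one in direction `true`.
  have key : ∀ x ∈ shortRelatorElements g, (∃ s, x = eval (path true s 1)) ∨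
      (∃ ε s k, k + 2 < 2 * g ∧ x = eval (path ε s (k + 2))) ∨
      ∃ s, x = eval (path true s (n + 3)) := by
    intro x hx
    obtain ⟨ε, s, k, hk, rfl⟩ := (mem_shortRelatorElements hg).1 hx
    rcases k with _ | k
    · exact Or.inl ⟨s, rfl⟩
    · rcases (show k + 2 ≤ 2 * g from hk).lt_or_eq with hk' | hk'
      · exact Or.inr (Or.inl ⟨ε, s, k, hk', rfl⟩)
      · obtain rfl : k = n + 1 := by omega
        cases ε
        · exact Or.inr (Or.inr ⟨nu true (bar s), by
            have := eval_path_half hg false s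
            rwa [← hn] at this⟩)
        · exact Or.inr (Or.inr ⟨s, rfl⟩)
  have ht := fun s => coneState_eval_path_top hg true s hn
  clear hn
  intro x hx y hy h
  rcases key x hx with ⟨s, rfl⟩ | ⟨ε, s, k, hk, rfl⟩ | ⟨s, rfl⟩ <;>
  rcases key y hy with ⟨t, rfl⟩ | ⟨δ, t, m, hm, rfl⟩ | ⟨t, rfl⟩ <;>
  simp only [coneState_eval_path_one, coneState_eval_path_run, *,
    run.injEq, one.injEq, reduceCtorEq, mkTop_inj] at h
  · rw [h]
  · simp [mkTop] at h
  · obtain ⟨rfl, h, hkm⟩ := h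
    obtain rfl : k = m := by omega
    rw [(nu_injective _).iterate _ h]
  · simp [mkTop] at h
  · simp [mkTop] at h
  · simp [mkTop] at h
  · rw [(nu_injective _).iterate _ h]

theorem image_coneState (hg : 2 ≤ g) :
    coneState hg '' shortRelatorElements g = {q | q.IsProper} := by
  ext q
  constructor
  · rintro ⟨x, hx, rfl⟩
    refine (isProper_coneState hg x).resolve_right fun h => ?_
    obtain ⟨ε, s, k, hk, rfl⟩ := (mem_shortRelatorElements hg).1 hx
    rw [coneState_eval_path hg ε s hk] at h
    have := isDown_step_bar (stateOf (walk ε s [] k)) ((nu ε)^[k] s)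
    rw [walk, stateOf] at h
    rwa [h] at this
  · exact fun hq => exists_coneState_eq hg hq

end SurfaceCone
-- The main theorem
open SurfaceCone in
theorem mainTheorem1 (g : ℕ) (hg : 2 ≤ g) :
    Set.range (coneType (g := g)) \ {coneType (1 : SurfaceGroup g)} =
        coneType '' shortRelatorElements g ∧
      Set.InjOn coneType (shortRelatorElements g) ∧
      (Set.range (coneType (g := g)) \ {coneType (1 : SurfaceGroup g)}).encard =
        ((8 * g * (2 * g - 1) : ℕ) : ℕ∞) ∧
      (Set.range (coneType (g := g))).encard = ((8 * g * (2 * g - 1) + 1 : ℕ) : ℕ∞) := by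
  have h1 : Set.range (coneType (g := g)) \ {coneType (1 : SurfaceGroup g)} =
      coneType '' shortRelatorElements g := by
    ext C
    constructor
    · rintro ⟨⟨x, rfl⟩, hx⟩
      rw [Set.mem_singleton_iff, coneType_eq_iff hg, coneState_one hg] at hx
      obtain ⟨y, hy, h⟩ := exists_coneState_eq hg ((isProper_coneState hg x).resolve_right hx)
      exact ⟨y, hy, (coneType_eq_iff hg).2 h⟩
    · rintro ⟨x, hx, rfl⟩
      refine ⟨⟨x, rfl⟩, fun h => ?_⟩
      rw [Set.mem_singleton_iff, coneType_eq_iff hg, coneState_one hg] at h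
      have h2 := Set.mem_image_of_mem (coneState hg) hx
      rw [image_coneState hg, h] at h2
      exact h2
  have h2 : Set.InjOn coneType (shortRelatorElements g) := fun x hx y hy h =>
    coneState_injOn hg hx hy ((coneType_eq_iff hg).1 h)
  have h3 : (coneType '' shortRelatorElements g).encard = ((8 * g * (2 * g - 1) : ℕ) : ℕ∞) := by
    rw [h2.encard_image, ← (coneState_injOn hg).encard_image, image_coneState,
      ConeState.encard_isProper hg]
  refine ⟨h1, h2, h1 ▸ h3, ?_⟩
  rw [← Set.encard_sdiff_singleton_add_one (Set.mem_range_self (1 : SurfaceGroup g)), h1, h3]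
  push_cast
  rfl
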